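/- Let $R=(a_1,b_1)\times(a_2,b_2)\subset\mathbb R^2$ be a bounded open rectangle. Let $-\Delta_N$ be the Neumann Laplacian on $R$, i.e. the self-adjoint operator on $L^2(R)$ associated with the quadratic form $\int_R|\nabla u|^2\,dx$, $u\in H^1(R)$; thus $-\Delta_N u=f$ (with $u\in H^1(R)$, $f\in L^2(R)$) means $\int_R\nabla u\cdot\nabla v\,dx=\int_R f v\,dx$ for all $v\in H^1(R)$. Then $-\Delta_N$ has a smallest nonzero eigenvalue $\lambda_1$, and $\lambda_1>0$. For every $r\in L^2(R)$ with $\int_R r\,dx=0$ there is a function $\phi\in H^1(R)$, unique up to null sets, with $\int_R\phi\,dx=0$ and $-\Delta_N\phi=r$, that is, the zero-mean weak solution of $-\Delta\phi=r$ in $R$, $\nabla\phi\cdot\mathbf n=0$ on $\partial R$; and it satisfies \[ \frac12\int_R r\,\phi\,dx\;\le\;\frac1{2\lambda_1}\int_R r^2\,dx . \] In particular, let $S_1,\dots,S_n\subset\mathbb R^2$ be measurable sets (module shapes) and $c=(c_1,\dots,c_n)\in(\mathbb R^2)^n$ positions such that the modules $M_i=c_i+S_i$ are contained in $\overline R$ (overlaps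 are allowed). Put $\rho(x;c)=\sum_{i=1}^n \mathbf 1_{M_i}(x)$, $\bar\rho=\frac1{|R|}\sum_{i=1}^n|M_i|$, $r(x;c)=\rho(x;c)-\bar\rho$. Then $r(\cdot;c)\in L^2(R)$ has integral zero, and with $\phi$ the corresponding solution above, the Poisson energy $E(c)=\frac12\int_R r(x;c)\,\phi(x)\,dx$ and the density variance $\mathrm{Var}(\rho)=\int_R(\rho(x;c)-\bar\rho)^2\,dx$ satisfy \[ E(c)\;\le\;\frac{1}{2\lambda_1}\,\mathrm{Var}(\rho). \] -/

import Mathlib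

open MeasureTheory Set
open scoped ContDiff Pointwise

noncomputable section

/-- The Euclidean plane. -/
abbrev Plane : Type := EuclideanSpace ℝ (Fin 2)

/-- The open rectangle `(a₀, b₀) × (a₁, b₁)`. -/
def openRectangle (a b : Fin 2 → ℝ) : Set Plane :=
  {x | ∀ i, x i ∈ Ioo (a i) (b i)}

/-- `g` is the weak (distributional) gradient of `u` on the open set `R`. -/
def HasWeakGradient (R : Set Plane) (u : Plane → ℝ) (g : Plane → Plane) : Prop :=
  ∀ η : Plane → ℝ, ContDiff ℝ ∞ η → HasCompactSupport η → tsupport η ⊆ R → ∀ i : Fin 2,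
    ∫ x in R, u x * fderiv ℝ η x (EuclideanSpace.single i 1) = -∫ x in R, g x i * η x

/-- `u` belongs to the Sobolev space `H¹(R)`, with weak gradient `g`. -/
structure MemH1 (R : Set Plane) (u : Plane → ℝ) (g : Plane → Plane) : Prop where
  memLp : MemLp u 2 (volume.restrict R)
  memLp_grad : MemLp g 2 (volume.restrict R)
  weakGradient : HasWeakGradient R u g

/-- `r` belongs to `L²₀(R)`, the square-integrable functions with integral zero. -/
structure MemL2Zero (R : Set Plane) (r : Plane → ℝ) : Prop where
  memLp : MemLp r 2 (volume.restrict R)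
  integral_eq_zero : ∫ x in R, r x = 0

/-- `u` lies in the domain of the Neumann Laplacian and `-Δ_N u = f`, where `-Δ_N` is the
operator on `L²(R)` associated with the quadratic form `∫_R |∇u|²` with form domain `H¹(R)`:
`∫_R ∇u · ∇v = ∫_R f v` for all `v ∈ H¹(R)`. -/
def NegNeumannLaplacianEq (R : Set Plane) (u f : Plane → ℝ) : Prop :=
  MemLp f 2 (volume.restrict R) ∧
  ∃ g : Plane → Plane, MemH1 R u g ∧
    ∀ (v : Plane → ℝ) (h : Plane → Plane), MemH1 R v h →
      ∫ x in R, inner ℝ (g x) (h x) = ∫ x in R, f x * v x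

/-- `μ` is an eigenvalue of `-Δ_N` on `R`. -/
def IsNeumannEigenvalue (R : Set Plane) (μ : ℝ) : Prop :=
  ∃ u : Plane → ℝ, ¬ (u =ᵐ[volume.restrict R] 0) ∧
    NegNeumannLaplacianEq R u (fun x => μ * u x)

/-- The nonzero eigenvalues of `-Δ_N` on `R`. -/
def nonzeroNeumannEigenvalues (R : Set Plane) : Set ℝ :=
  {μ | μ ≠ 0 ∧ IsNeumannEigenvalue R μ}

/-- The first nonzero eigenvalue `λ₁` of `-Δ_N` on `R`. -/
def firstNeumannEigenvalue (R : Set Plane) : ℝ :=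
  sInf (nonzeroNeumannEigenvalues R)

/-- `φ` is a zero-mean weak solution of `-Δφ = r` in `R`, `∇φ · n = 0` on `∂R`. -/
def IsPoissonPotential (R : Set Plane) (r φ : Plane → ℝ) : Prop :=
  NegNeumannLaplacianEq R φ r ∧ ∫ x in R, φ x = 0

/-- The zero-mean solution of the Neumann problem with right-hand side `r`
(unique up to null sets). -/
def poissonPotential (R : Set Plane) (r : Plane → ℝ) : Plane → ℝ :=
  Classical.epsilon (IsPoissonPotential R r)

/-- The Poisson energy `½ ∫_R r φ` of a residual density `r`. -/
def poissonEnergy (R : Set Plane) (r : Plane → ℝ) : ℝ :=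
  1 / 2 * ∫ x in R, r x * poissonPotential R r x

/-- The region occupied by a module of shape `S` placed at `c`. -/
def placedModule (S : Set Plane) (c : Plane) : Set Plane := c +ᵥ S

/-- The aggregate density `ρ(x; c) = ∑ᵢ 1_{Mᵢ}(x)`. -/
def density {n : ℕ} (S : Fin n → Set Plane) (c : Fin n → Plane) (x : Plane) : ℝ :=
  ∑ i, (placedModule (S i) (c i)).indicator (fun _ => (1 : ℝ)) x

/-- The average density `ρ̄ = (1/|R|) ∑ᵢ Aᵢ`, with `Aᵢ` the area of the `i`-th module. -/
def averageDensity (R : Set Plane) {n : ℕ} (S : Fin n → Set Plane) : ℝ :=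
  1 / volume.real R * ∑ i, volume.real (S i)

/-- The residual density `r(x; c) = ρ(x; c) - ρ̄`. -/
def residualDensity (R : Set Plane) {n : ℕ} (S : Fin n → Set Plane) (c : Fin n → Plane)
    (x : Plane) : ℝ :=
  density S c x - averageDensity R S

/-- The Poisson energy `E(c)` of a floorplan. -/
def floorplanEnergy (R : Set Plane) {n : ℕ} (S : Fin n → Set Plane) (c : Fin n → Plane) : ℝ :=
  poissonEnergy R (residualDensity R S c)

/-- The variance `Var(ρ) = ∫_R (ρ - ρ̄)²` of a floorplan. -/
def densityVariance (R : Set Plane) {n : ℕ} (S : Fin n → Set Plane) (c : Fin n → Plane) : ℝ :=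
  ∫ x in R, (density S c x - averageDensity R S) ^ 2

end

/-! ### Consequences of a Neumann eigenbasis on a general set `R`. -/

section AbstractSpectralTheory

/-! The argument is separation of variables. In an orthonormal basis `e_k` of Neumann eigenfunctions
with eigenvalues `λ_k`, the equation `-Δ_N φ = r` reads `λ_k ⟨e_k, φ⟩ = ⟨e_k, r⟩` (`eig_mul_coeff`).
By Parseval, `∫ r φ` is the sum of `⟨e_k, r⟩² / λ_k` over the nonconstant modes, hence at most `λ₁⁻¹
∫ r²`. The same formula gives uniqueness, and existence follows by summing the series; its gradient
converges because the gradients of the modes are orthogonal with squared norm `λ_k`.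

It remains to show that products of cosines form such a basis (`nonempty_neumannEigenbasis`), and
two points need work. The eigenvalue equation must hold against every `v` in `H¹`, although the weak
gradient is tested only against compactly supported functions. Neither traces nor density of smooth
functions is used: the differentiated cosine is a sine vanishing linearly at the two relevant sides,
so smooth cutoffs with derivative `O(1 / distance)` can be removed by dominated convergence
(`exists_cutoff`, `MemH1.integral_mul_prodFun`). Completeness follows from Stone–Weierstrass, since
the span of the modes is an algebra separating the points of the closed rectangle
(`exists_cosPolynomial_near`). -/

theorem inner_toLp_toLp {α E : Type*} [MeasurableSpace α] {μ : Measure α}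
    [NormedAddCommGroup E] [InnerProductSpace ℝ E] {f g : α → E}
    (hf : MemLp f 2 μ) (hg : MemLp g 2 μ) :
    inner ℝ (hf.toLp f) (hg.toLp g) = ∫ x, inner ℝ (f x) (g x) ∂μ := by
  rw [L2.inner_def]
  refine integral_congr_ae ?_
  filter_upwards [hf.coeFn_toLp, hg.coeFn_toLp] with x h1 h2
  rw [h1, h2]

theorem inner_coe_toLp {α : Type*} [MeasurableSpace α] {μ : Measure α} (f : Lp ℝ 2 μ)
    {g : α → ℝ} (hg : MemLp g 2 μ) :
    inner ℝ f (hg.toLp g) = ∫ x, f x * g x ∂μ := by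
  rw [L2.inner_def]
  refine integral_congr_ae ?_
  filter_upwards [hg.coeFn_toLp] with x h
  rw [h]
  simp [mul_comm]

theorem Orthonormal.summable_smul {ι E : Type*} [NormedAddCommGroup E] [InnerProductSpace ℝ E]
    [CompleteSpace E] {v : ι → E} (hv : Orthonormal ℝ v) {c : ι → ℝ}
    (hc : Summable fun i => c i ^ 2) : Summable fun i => c i • v i := by
  have := (hv.orthogonalFamily.summable_iff_norm_sq_summable c).2 (by simpa using hc)
  simpa using this

theorem MemH1.congr_ae {R : Set Plane} {u u' : Plane → ℝ} {g g' : Plane → Plane}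
    (h : MemH1 R u g) (hu : u =ᵐ[volume.restrict R] u') (hg : g =ᵐ[volume.restrict R] g') :
    MemH1 R u' g' where
  memLp := (memLp_congr_ae hu).1 h.memLp
  memLp_grad := (memLp_congr_ae hg).1 h.memLp_grad
  weakGradient := by
    intro η h1 h2 h3 i
    have := h.weakGradient η h1 h2 h3 i
    have e1 : ∫ x in R, u x * fderiv ℝ η x (EuclideanSpace.single i 1) =
        ∫ x in R, u' x * fderiv ℝ η x (EuclideanSpace.single i 1) :=
      integral_congr_ae (hu.mono fun x hx => by simp only [hx])
    have e2 : ∫ x in R, g x i * η x = ∫ x in R, g' x i * η x :=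
      integral_congr_ae (hg.mono fun x hx => by simp only [hx])
    rw [← e1, ← e2, this]

theorem MemH1.const_mul {R : Set Plane} {u : Plane → ℝ} {g : Plane → Plane}
    (h : MemH1 R u g) (c : ℝ) : MemH1 R (fun x => c * u x) (fun x => c • g x) where
  memLp := h.memLp.const_mul c
  memLp_grad := h.memLp_grad.const_smul c
  weakGradient := by
    intro η h1 h2 h3 i
    have := h.weakGradient η h1 h2 h3 i
    simp only [PiLp.smul_apply, smul_eq_mul, mul_assoc, integral_const_mul]
    rw [this, mul_neg]

theorem Continuous.memLp_two_restrict_of_hasCompactSupport {η : Plane → ℝ} (h1 : Continuous η)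
    (h2 : HasCompactSupport η) (R : Set Plane) : MemLp η 2 (volume.restrict R) :=
  (h1.memLp_of_hasCompactSupport h2).restrict R

/-- The weak gradient is a closed operator: it may be computed term by term in convergent
series. -/
theorem memH1_of_hasSum {R : Set Plane} {ι : Type*} {u : ι → Plane → ℝ}
    {g : ι → Plane → Plane} (h : ∀ k, MemH1 R (u k) (g k))
    {U : Lp ℝ 2 (volume.restrict R)} {G : Lp Plane 2 (volume.restrict R)}
    (hU : HasSum (fun k => (h k).memLp.toLp (u k)) U)
    (hG : HasSum (fun k => (h k).memLp_grad.toLp (g k)) G) : MemH1 R U G where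
  memLp := Lp.memLp U
  memLp_grad := Lp.memLp G
  weakGradient := by
    intro η h1 h2 h3 i
    have hη' : Continuous fun x => fderiv ℝ η x (EuclideanSpace.single i 1) :=
      (h1.continuous_fderiv (by simp)).clm_apply continuous_const
    have m1 : MemLp (fun x => fderiv ℝ η x (EuclideanSpace.single i 1)) 2 (volume.restrict R) :=
      Continuous.memLp_two_restrict_of_hasCompactSupport hη' (h2.fderiv_apply ℝ _) R
    have hv : Continuous fun x => (EuclideanSpace.single i (η x) : Plane) := by
      have : (fun x => (EuclideanSpace.single i (η x) : Plane)) =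
          fun x => η x • (EuclideanSpace.single i 1 : Plane) := by
        ext x j
        simp
      rw [this]
      exact h1.continuous.smul continuous_const
    have m2 : MemLp (fun x => (EuclideanSpace.single i (η x) : Plane)) 2
        (volume.restrict R) := by
      refine (hv.memLp_of_hasCompactSupport (h2.comp_left (g := fun t => EuclideanSpace.single i t)
        ?_)).restrict R
      simp
    -- Both sides of the weak gradient identity are continuous linear functionals on `L²`: pairings
    -- with `∂ᵢη` and with the vector field `η eᵢ`. They therefore commute with the sums.
    have a1 := hU.mapL (innerSL ℝ (m1.toLp _))
    have a2 := (hG.mapL (innerSL ℝ (m2.toLp _))).neg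
    have key : ∀ k, innerSL ℝ (m1.toLp _) ((h k).memLp.toLp (u k)) =
        -innerSL ℝ (m2.toLp _) ((h k).memLp_grad.toLp (g k)) := by
      intro k
      have := (h k).weakGradient η h1 h2 h3 i
      simp only [innerSL_apply_apply, inner_toLp_toLp]
      simpa [EuclideanSpace.inner_single_left, mul_comm] using this
    simp only [key] at a1
    have := a1.unique a2
    rw [← Lp.toLp_coeFn U (Lp.memLp U), ← Lp.toLp_coeFn G (Lp.memLp G)] at this
    simp only [innerSL_apply_apply, inner_toLp_toLp] at this
    simpa [EuclideanSpace.inner_single_left, mul_comm] using this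

/-- A Hilbert basis of `L²(R)` consisting of Neumann eigenfunctions, with a constant mode and
a first nonconstant one. -/
structure NeumannEigenbasis (R : Set Plane) (ι : Type*) where
  basis : HilbertBasis ι ℝ (Lp ℝ 2 (volume.restrict R))
  grad : ι → Plane → Plane
  eig : ι → ℝ
  memH1 : ∀ k, MemH1 R (basis k) (grad k)
  weak : ∀ k v h, MemH1 R v h →
    ∫ x in R, inner ℝ (grad k x) (h x) = eig k * ∫ x in R, basis k x * v x
  zero : ι
  eig_zero : eig zero = 0
  const_zero : ∃ c : ℝ, c ≠ 0 ∧ basis zero =ᵐ[volume.restrict R] fun _ => c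
  first : ι
  eig_first_pos : 0 < eig first
  eig_first_le : ∀ k, k ≠ zero → eig first ≤ eig k

namespace NeumannEigenbasis

variable {R : Set Plane} {ι : Type*} (B : NeumannEigenbasis R ι)


theorem eig_pos {k : ι} (hk : k ≠ B.zero) : 0 < B.eig k :=
  B.eig_first_pos.trans_le (B.eig_first_le k hk)

theorem negNeumannLaplacianEq_basis (k : ι) :
    NegNeumannLaplacianEq R (B.basis k) (fun x => B.eig k * B.basis k x) := by
  refine ⟨(Lp.memLp _).const_mul _, B.grad k, B.memH1 k, fun v h hv => ?_⟩
  rw [B.weak k v h hv]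
  simp only [mul_assoc, integral_const_mul]

/-- The equation for `u` is tested against the mode, and the equation of the mode against `u`; the
symmetry of the Dirichlet form equates the two results. -/
theorem eig_mul_coeff {u f : Plane → ℝ} (hu : MemLp u 2 (volume.restrict R))
    (hf : MemLp f 2 (volume.restrict R)) (h : NegNeumannLaplacianEq R u f) (k : ι) :
    B.eig k * inner ℝ (B.basis k) (hu.toLp u) = inner ℝ (B.basis k) (hf.toLp f) := by
  obtain ⟨-, g, hg, hw⟩ := h
  rw [inner_coe_toLp, inner_coe_toLp, ← B.weak k u g hg]
  have := hw _ _ (B.memH1 k)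
  simp only [mul_comm (B.basis k _), ← this]
  exact integral_congr_ae (.of_forall fun x => real_inner_comm _ _)

theorem ext_coeff {x y : Lp ℝ 2 (volume.restrict R)}
    (h : ∀ k, inner ℝ (B.basis k) x = inner ℝ (B.basis k) y) : x = y := by
  apply B.basis.repr.injective
  ext k
  simp only [HilbertBasis.repr_apply_apply, h]

theorem isNeumannEigenvalue_iff {μ : ℝ} : IsNeumannEigenvalue R μ ↔ ∃ k, B.eig k = μ := by
  constructor
  · rintro ⟨u, hu0, h⟩
    obtain ⟨hf, g, hg, -⟩ := id h
    have hu := hg.memLp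
    -- If `μ` differs from every `eig k`, then `(eig k - μ) ⟨e_k, u⟩ = 0` kills all coefficients of
    -- `u`.
    by_contra! hne
    apply hu0
    have hz : hu.toLp u = 0 := by
      refine B.ext_coeff fun k => ?_
      have h1 := B.eig_mul_coeff hu hf h k
      have h2 : hf.toLp (fun x => μ * u x) = μ • hu.toLp u := MemLp.toLp_const_smul μ hu
      rw [h2, inner_smul_right] at h1
      have h3 : (B.eig k - μ) * inner ℝ (B.basis k) (hu.toLp u) = 0 := by linarith
      rw [inner_zero_right]
      exact (mul_eq_zero.1 h3).resolve_left (sub_ne_zero.2 (hne k))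
    exact hu.coeFn_toLp.symm.trans (Lp.eq_zero_iff_ae_eq_zero.1 hz)
  · rintro ⟨k, rfl⟩
    refine ⟨B.basis k, fun h0 => ?_, B.negNeumannLaplacianEq_basis k⟩
    exact B.basis.orthonormal.ne_zero k ((Lp.eq_zero_iff_ae_eq_zero).2 h0)

theorem isLeast_nonzeroNeumannEigenvalues :
    IsLeast (nonzeroNeumannEigenvalues R) (B.eig B.first) := by
  refine ⟨⟨B.eig_first_pos.ne', B.isNeumannEigenvalue_iff.2 ⟨_, rfl⟩⟩, ?_⟩
  rintro μ ⟨h0, h⟩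
  obtain ⟨k, rfl⟩ := B.isNeumannEigenvalue_iff.1 h
  exact B.eig_first_le k fun hk => h0 (hk ▸ B.eig_zero)

theorem firstNeumannEigenvalue_eq : firstNeumannEigenvalue R = B.eig B.first :=
  B.isLeast_nonzeroNeumannEigenvalues.csInf_eq

theorem inner_basis_zero_eq_zero_iff {u : Plane → ℝ} (hu : MemLp u 2 (volume.restrict R)) :
    inner ℝ (B.basis B.zero) (hu.toLp u) = 0 ↔ ∫ x in R, u x = 0 := by
  obtain ⟨c, hc, h⟩ := B.const_zero
  rw [inner_coe_toLp, integral_congr_ae (g := fun x => c * u x), integral_const_mul,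
    mul_eq_zero, or_iff_right hc]
  filter_upwards [h] with x hx
  rw [hx]

include B in
theorem poissonPotential_unique {r φ φ' : Plane → ℝ} (h : IsPoissonPotential R r φ)
    (h' : IsPoissonPotential R r φ') : φ =ᵐ[volume.restrict R] φ' := by
  obtain ⟨⟨hr, g, hg, hw⟩, hz⟩ := id h
  obtain ⟨⟨-, g', hg', hw'⟩, hz'⟩ := id h'
  rw [← MemLp.toLp_eq_toLp_iff hg.memLp hg'.memLp]
  refine B.ext_coeff fun k => ?_
  by_cases hk : k = B.zero
  · subst hk
    rw [(B.inner_basis_zero_eq_zero_iff hg.memLp).2 hz,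
      (B.inner_basis_zero_eq_zero_iff hg'.memLp).2 hz']
  · have h1 := B.eig_mul_coeff hg.memLp hr h.1 k
    rw [← B.eig_mul_coeff hg'.memLp hr h'.1 k] at h1
    exact mul_left_cancel₀ (B.eig_pos hk).ne' h1

theorem integral_mul_poissonPotential_le {r φ : Plane → ℝ}
    (h : IsPoissonPotential R r φ) :
    ∫ x in R, r x * φ x ≤ (B.eig B.first)⁻¹ * ∫ x in R, r x ^ 2 := by
  obtain ⟨⟨hr', g, hg, hw⟩, hz⟩ := id h
  have e1 : ∫ x in R, r x * φ x = inner ℝ (hr'.toLp r) (hg.memLp.toLp φ) := by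
    rw [inner_toLp_toLp]
    simp [mul_comm]
  have e2 : ∫ x in R, r x ^ 2 = inner ℝ (hr'.toLp r) (hr'.toLp r) := by
    rw [inner_toLp_toLp]
    simp [sq]
  rw [e1, e2]
  -- Parseval on both sides, compared termwise: with `t = ⟨e_k, φ⟩`, the claim is `λ_k t² ≤ λ₁⁻¹
  -- λ_k² t²`. Both sides vanish at the zero mode.
  refine hasSum_le (fun k => ?_) (B.basis.hasSum_inner_mul_inner _ _)
    ((B.basis.hasSum_inner_mul_inner _ _).mul_left _)
  rw [real_inner_comm, ← B.eig_mul_coeff hg.memLp hr' h.1 k]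
  by_cases hk : k = B.zero
  · subst hk
    simp [B.eig_zero]
  · have h1 := B.eig_first_le k hk
    have h2 := B.eig_first_pos
    have h3 := B.eig_pos hk
    set t := inner ℝ (B.basis k) (hg.memLp.toLp φ)
    have : (B.eig B.first)⁻¹ * (B.eig k * t * (B.eig k * t)) =
        (B.eig k / B.eig B.first) * (B.eig k * t * t) := by
      field_simp
    rw [this]
    refine le_mul_of_one_le_left ?_ ((one_le_div h2).2 h1)
    nlinarith [mul_self_nonneg t]

/-- The normalized gradients of the nonconstant modes. -/
noncomputable def normalizedGrad (k : {k // k ≠ B.zero}) : Lp Plane 2 (volume.restrict R) :=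
  (√(B.eig k))⁻¹ • (B.memH1 k).memLp_grad.toLp (B.grad k)

theorem inner_grad_toLp (k : ι) {v : Plane → ℝ} {h : Plane → Plane} (hv : MemH1 R v h) :
    inner ℝ ((B.memH1 k).memLp_grad.toLp (B.grad k)) (hv.memLp_grad.toLp h) =
      B.eig k * inner ℝ (B.basis k) (hv.memLp.toLp v) := by
  rw [inner_toLp_toLp, inner_coe_toLp, B.weak k v h hv]

/-- Testing the equation of one mode against another gives `⟨∇e_k, ∇e_l⟩ = λ_k δ_kl`. -/
theorem orthonormal_normalizedGrad : Orthonormal ℝ B.normalizedGrad := by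
  classical
  rw [orthonormal_iff_ite]
  rintro ⟨k, hk⟩ ⟨l, hl⟩
  simp only [normalizedGrad, inner_smul_left, inner_smul_right, B.inner_grad_toLp k (B.memH1 l),
    Lp.toLp_coeFn, orthonormal_iff_ite.1 B.basis.orthonormal, Subtype.mk.injEq]
  have h3 := B.eig_pos hk
  split_ifs with h
  · subst h
    have := Real.mul_self_sqrt h3.le
    have h4 := (Real.sqrt_pos.2 h3).ne'
    simp only [conj_trivial]
    field_simp
    nlinarith
  · simp

-- The potential is the series of `(c k / eig k) e_k` over the nonconstant modes. The zero-mean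
-- condition is the solvability condition `c zero = 0`.
include B in
theorem exists_isPoissonPotential {r : Plane → ℝ} (hr : MemL2Zero R r) :
    ∃ φ, IsPoissonPotential R r φ := by
  set c : ι → ℝ := fun k => inner ℝ (B.basis k) (hr.memLp.toLp r) with hc
  have hc0 : c B.zero = 0 := (B.inner_basis_zero_eq_zero_iff hr.memLp).2 hr.integral_eq_zero
  have hcs : Summable fun k : {k // k ≠ B.zero} => c k ^ 2 := by
    have := B.basis.orthonormal.inner_products_summable (hr.memLp.toLp r)
    simp only [Real.norm_eq_abs, sq_abs] at this
    exact this.comp_injective (Subtype.val_injective (p := fun k => k ≠ B.zero))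
  have horth : Orthonormal ℝ fun k : {k // k ≠ B.zero} => B.basis k :=
    B.basis.orthonormal.comp _ Subtype.val_injective
  have hpos := B.eig_first_pos
  have s1 : Summable fun k : {k // k ≠ B.zero} => (c k / B.eig k) • B.basis k := by
    refine horth.summable_smul (Summable.of_nonneg_of_le (fun _ => sq_nonneg _) (fun k => ?_)
      (hcs.mul_left ((B.eig B.first ^ 2)⁻¹)))
    rw [div_pow, div_eq_inv_mul]
    have := B.eig_first_le k k.2
    gcongr
  have s2 : Summable fun k : {k // k ≠ B.zero} =>
      (c k / B.eig k) • (B.memH1 k).memLp_grad.toLp (B.grad k) := by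
    -- Relative to the orthonormal gradients the coefficients are `c k / √(eig k)`, square-summable
    -- because `eig k` is bounded below by `eig first`.
    have : Summable fun k : {k // k ≠ B.zero} => (c k / √(B.eig k)) • B.normalizedGrad k := by
      refine B.orthonormal_normalizedGrad.summable_smul
        (Summable.of_nonneg_of_le (fun _ => sq_nonneg _) (fun k => ?_)
        (hcs.mul_left ((B.eig B.first)⁻¹)))
      have := B.eig_first_le k k.2
      rw [div_pow, div_eq_inv_mul, Real.sq_sqrt (hpos.le.trans this)]
      gcongr
    refine this.congr fun k => ?_
    rw [normalizedGrad, smul_smul, ← div_eq_mul_inv, div_div,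
      Real.mul_self_sqrt (B.eig_pos k.2).le]
  obtain ⟨Φ, hΦ⟩ := s1
  obtain ⟨G, hG⟩ := s2
  have hH1 : MemH1 R Φ G := by
    refine memH1_of_hasSum
      (fun k : {k // k ≠ B.zero} => (B.memH1 k).const_mul (c k / B.eig k)) ?_ ?_
    · convert hΦ using 2 with k
      exact (MemLp.toLp_const_smul (c k / B.eig k) (Lp.memLp (B.basis k))).trans
        (by rw [Lp.toLp_coeFn])
    · convert hG using 2 with k
      exact MemLp.toLp_const_smul (c k / B.eig k) (B.memH1 k).memLp_grad
  refine ⟨Φ, ⟨hr.memLp, G, hH1, fun v h hv => ?_⟩, ?_⟩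
  · have a1 := hG.mapL (innerSL ℝ (hv.memLp_grad.toLp h))
    have a2 := (B.basis.hasSum_inner_mul_inner (hr.memLp.toLp r) (hv.memLp.toLp v))
    -- The zero mode drops out of Parseval's sum since `c zero = 0`, so both sums run over the same
    -- indices.
    have a3 := (hasSum_subtype_iff_of_support_subset (s := {k | k ≠ B.zero}) (fun k hk h0 => by
      subst h0
      exact hk (mul_eq_zero_of_left ((real_inner_comm _ _).trans hc0) _))).2 a2
    have key : ∀ k : {k // k ≠ B.zero}, innerSL ℝ (hv.memLp_grad.toLp h)
        ((c k / B.eig k) • (B.memH1 k).memLp_grad.toLp (B.grad k)) =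
        inner ℝ (hr.memLp.toLp r) (B.basis k) * inner ℝ (B.basis k) (hv.memLp.toLp v) := by
      intro k
      rw [innerSL_apply_apply, inner_smul_right, real_inner_comm, B.inner_grad_toLp k hv,
        real_inner_comm (B.basis k)]
      have := (B.eig_pos k.2).ne'
      simp only [hc]
      field_simp
    simp only [key] at a1
    have e := a1.unique a3
    rw [innerSL_apply_apply, real_inner_comm, ← Lp.toLp_coeFn G (Lp.memLp G), inner_toLp_toLp,
      inner_toLp_toLp] at e
    rw [e]
    simp [mul_comm]
  · rw [← B.inner_basis_zero_eq_zero_iff (Lp.memLp Φ), Lp.toLp_coeFn]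
    have a1 := hΦ.mapL (innerSL ℝ (B.basis B.zero))
    have key : ∀ k : {k // k ≠ B.zero}, innerSL ℝ (B.basis B.zero)
        ((c k / B.eig k) • B.basis k) = 0 := by
      intro k
      rw [innerSL_apply_apply, inner_smul_right, B.basis.orthonormal.2 k.2.symm, mul_zero]
    simp only [key] at a1
    exact a1.unique hasSum_zero

include B in
theorem poissonEnergy_le {r : Plane → ℝ} (hr : MemL2Zero R r) :
    poissonEnergy R r ≤ 1 / (2 * firstNeumannEigenvalue R) * ∫ x in R, r x ^ 2 := by
  -- Existence makes the function chosen by `Classical.epsilon` a genuine solution.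
  have h := B.integral_mul_poissonPotential_le
    (Classical.epsilon_spec (B.exists_isPoissonPotential hr))
  rw [B.firstNeumannEigenvalue_eq, poissonEnergy, poissonPotential]
  have : 1 / (2 * B.eig B.first) * ∫ x in R, r x ^ 2 =
      1 / 2 * ((B.eig B.first)⁻¹ * ∫ x in R, r x ^ 2) := by
    rw [one_div, mul_inv]
    ring
  rw [this]
  gcongr

end NeumannEigenbasis

end AbstractSpectralTheory

/-! ### Cutoffs and integration by parts on the rectangle. -/

section Rectangle

open Filter Topology

theorem isOpen_openRectangle (a b : Fin 2 → ℝ) : IsOpen (openRectangle a b) := by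
  have : openRectangle a b = ⋂ i, (fun x : Plane => x i) ⁻¹' Ioo (a i) (b i) := by
    ext x
    simp [openRectangle]
  rw [this]
  exact isOpen_iInter_of_finite fun i => isOpen_Ioo.preimage (by fun_prop)

theorem convex_openRectangle (a b : Fin 2 → ℝ) : Convex ℝ (openRectangle a b) := by
  intro x hx y hy s t hs ht hst i
  exact convex_Ioo (a i) (b i) (hx i) (hy i) hs ht hst

/-- The closed rectangle `[a₀, b₀] × [a₁, b₁]`. -/
def closedRectangle (a b : Fin 2 → ℝ) : Set Plane :=
  {x | ∀ i, x i ∈ Icc (a i) (b i)}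

theorem isCompact_closedRectangle (a b : Fin 2 → ℝ) : IsCompact (closedRectangle a b) := by
  have h : IsCompact (Set.pi univ fun i => Icc (a i) (b i)) :=
    isCompact_univ_pi fun i => isCompact_Icc
  have := (EuclideanSpace.equiv (Fin 2) ℝ).toHomeomorph.isCompact_preimage.2 h
  convert this using 1
  ext x
  exact (Set.mem_univ_pi (f := x.ofLp)).symm

theorem openRectangle_subset_closedRectangle (a b : Fin 2 → ℝ) :
    openRectangle a b ⊆ closedRectangle a b :=
  fun _ hx i => Ioo_subset_Icc_self (hx i)

theorem volume_openRectangle_lt_top (a b : Fin 2 → ℝ) : volume (openRectangle a b) < ⊤ :=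
  (measure_mono (openRectangle_subset_closedRectangle a b)).trans_lt
    (isCompact_closedRectangle a b).measure_lt_top

instance isFiniteMeasure_restrict_openRectangle (a b : Fin 2 → ℝ) :
    IsFiniteMeasure ((volume : Measure Plane).restrict (openRectangle a b)) :=
  isFiniteMeasure_restrict.2 (volume_openRectangle_lt_top a b).ne

theorem openRectangle_nonempty {a b : Fin 2 → ℝ} (hab : ∀ i, a i < b i) :
    (openRectangle a b).Nonempty := by
  choose m hm using fun i => exists_between (hab i)
  exact ⟨WithLp.toLp 2 m, fun i => hm i⟩

/-- The product `x ↦ f₀(x₀) f₁(x₁)` of functions of one variable. -/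
def prodFun (f : Fin 2 → ℝ → ℝ) (x : Plane) : ℝ := ∏ j, f j (x j)

theorem contDiff_prodFun {f : Fin 2 → ℝ → ℝ} (hf : ∀ j, ContDiff ℝ ∞ (f j)) :
    ContDiff ℝ ∞ (prodFun f) := by
  unfold prodFun
  refine contDiff_prod fun j _ => (hf j).comp ?_
  fun_prop

theorem continuous_prodFun {f : Fin 2 → ℝ → ℝ} (hf : ∀ j, Continuous (f j)) :
    Continuous (prodFun f) := by
  unfold prodFun
  exact continuous_finsetProd _ fun j _ => (hf j).comp (by fun_prop)

theorem fderiv_prodFun {f : Fin 2 → ℝ → ℝ} (hf : ∀ j, Differentiable ℝ (f j)) (x : Plane)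
    (i : Fin 2) : fderiv ℝ (prodFun f) x (EuclideanSpace.single i 1) =
      prodFun (Function.update f i (deriv (f i))) x := by
  have h : ∀ j ∈ Finset.univ, HasFDerivAt (fun x : Plane => f j (x j))
      (deriv (f j) (x j) • (EuclideanSpace.proj j : Plane →L[ℝ] ℝ)) x := by
    intro j _
    exact (hf j (x j)).hasDerivAt.comp_hasFDerivAt x
      (EuclideanSpace.proj j : Plane →L[ℝ] ℝ).hasFDerivAt
  have := HasFDerivAt.finsetProd h
  unfold prodFun
  rw [this.fderiv]
  have h0 : Finset.univ.erase (0 : Fin 2) = {1} := by decide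
  have h1 : Finset.univ.erase (1 : Fin 2) = {0} := by decide
  fin_cases i <;> simp [Fin.prod_univ_two, Fin.sum_univ_two, Function.update, mul_comm, h0, h1]

theorem abs_prodFun_le {f : Fin 2 → ℝ → ℝ} {C : Fin 2 → ℝ} {x : Plane}
    (h : ∀ j, |f j (x j)| ≤ C j) : |prodFun f x| ≤ ∏ j, C j := by
  unfold prodFun
  rw [Finset.abs_prod]
  exact Finset.prod_le_prod (fun _ _ => abs_nonneg _) fun j _ => h j

theorem tendsto_integral_mul_prodFun {a b : Fin 2 → ℝ} {u : Plane → ℝ}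
    (hu : IntegrableOn u (openRectangle a b)) {F : ℕ → Fin 2 → ℝ → ℝ} {f : Fin 2 → ℝ → ℝ}
    {C : Fin 2 → ℝ} (hF : ∀ n j, Continuous (F n j))
    (hC : ∀ n j, ∀ t ∈ Ioo (a j) (b j), |F n j t| ≤ C j)
    (hlim : ∀ j, ∀ t ∈ Ioo (a j) (b j), Tendsto (fun n => F n j t) atTop (𝓝 (f j t))) :
    Tendsto (fun n => ∫ x in openRectangle a b, u x * prodFun (F n) x) atTop
      (𝓝 (∫ x in openRectangle a b, u x * prodFun f x)) := by
  refine tendsto_integral_of_dominated_convergence (fun x => ‖u x‖ * ∏ j, C j) (fun n => ?_)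
    (hu.norm.mul_const _) (fun n => ?_) ?_
  · exact hu.aestronglyMeasurable.mul (continuous_prodFun (hF n)).aestronglyMeasurable
  · refine (ae_restrict_iff' (isOpen_openRectangle a b).measurableSet).2 (.of_forall ?_)
    intro x hx
    rw [norm_mul]
    gcongr
    exact abs_prodFun_le fun j => hC n j _ (hx j)
  · refine (ae_restrict_iff' (isOpen_openRectangle a b).measurableSet).2 (.of_forall ?_)
    intro x hx
    exact tendsto_const_nhds.mul (tendsto_finsetProd _ fun j _ => hlim j _ (hx j))

/-- This is the scale-invariant form of `|θ'| ≤ D / distance`: for a cutoff `σ ((n + 1) d - 1)` of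
the distance `d`, with `s = (n + 1) d - 1`, the product of its derivative and `d` is `σ' s * (s +
1)`, whatever `n` is. Compactness handles `s ≤ 1`; beyond, the transition is constant. -/
theorem exists_bound_deriv_smoothTransition :
    ∃ D, ∀ s, -1 < s → |deriv Real.smoothTransition s| * (s + 1) ≤ D := by
  have hc : Continuous fun s : ℝ => |deriv Real.smoothTransition s| * (s + 1) :=
    ((Real.smoothTransition.contDiff (n := 1)).continuous_deriv le_rfl).abs.mul (by fun_prop)
  obtain ⟨D, hD⟩ := (isCompact_Icc (a := (-1 : ℝ)) (b := 1)).exists_bound_of_continuousOn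
    hc.continuousOn
  refine ⟨max D 0, fun s hs => ?_⟩
  by_cases h : s ≤ 1
  · exact (le_abs_self _).trans ((hD s ⟨hs.le, h⟩).trans (le_max_left _ _))
  · have : deriv Real.smoothTransition s = 0 := by
      have : Real.smoothTransition =ᶠ[𝓝 s] fun _ => 1 := by
        filter_upwards [lt_mem_nhds (not_le.1 h)] with t ht
        exact Real.smoothTransition.one_of_one_le ht.le
      rw [this.deriv_eq, deriv_const]
    simp [this]

/-- Smooth cutoff functions exhausting an interval, with derivatives controlled by the inverse
distance to the end points. -/
theorem exists_cutoff (a b : ℝ) : ∃ θ : ℕ → ℝ → ℝ, ∃ D : ℝ,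
    (∀ n, ContDiff ℝ ∞ (θ n)) ∧ (∀ n t, |θ n t| ≤ 1) ∧
    (∀ n, ∃ δ > 0, ∀ t, t ∉ Icc (a + δ) (b - δ) → θ n t = 0) ∧
    (∀ t ∈ Ioo a b, Tendsto (fun n => θ n t) atTop (𝓝 1)) ∧
    (∀ t ∈ Ioo a b, Tendsto (fun n => deriv (θ n) t) atTop (𝓝 0)) ∧
    ∀ n, ∀ t ∈ Ioo a b, |deriv (θ n) t| * min (t - a) (b - t) ≤ D := by
  obtain ⟨D, hD⟩ := exists_bound_deriv_smoothTransition
  set σ := Real.smoothTransition with hσ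
  have hσd : Differentiable ℝ σ :=
    (Real.smoothTransition.contDiff (n := 1)).differentiable (by simp)
  -- The transition takes place at distances between `1 / (n + 1)` and `2 / (n + 1)` from each end
  -- point.
  let p : ℕ → ℝ → ℝ := fun n t => ((n : ℝ) + 1) * (t - a) - 1
  let q : ℕ → ℝ → ℝ := fun n t => ((n : ℝ) + 1) * (b - t) - 1
  have hbd : ∀ s, |σ s| ≤ 1 := fun s => by
    rw [abs_of_nonneg (Real.smoothTransition.nonneg s)]
    exact Real.smoothTransition.le_one s
  have hder : ∀ n t, HasDerivAt (fun t => σ (p n t) * σ (q n t))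
      (deriv σ (p n t) * ((n : ℝ) + 1) * σ (q n t) +
        σ (p n t) * (deriv σ (q n t) * -((n : ℝ) + 1))) t := by
    intro n t
    have h1 : HasDerivAt (p n) ((n : ℝ) + 1) t := by
      simpa [p] using ((hasDerivAt_id t).sub_const a).const_mul ((n : ℝ) + 1)
    have h2 : HasDerivAt (q n) (-((n : ℝ) + 1)) t := by
      simpa [q] using ((hasDerivAt_id t).const_sub b).const_mul ((n : ℝ) + 1)
    exact ((hσd (p n t)).hasDerivAt.comp t h1).mul ((hσd (q n t)).hasDerivAt.comp t h2)
  -- Being equal to 1 on a neighbourhood of `t` settles the limits of both the cutoff and its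
  -- derivative.
  have hev : ∀ t ∈ Ioo a b, ∀ᶠ n : ℕ in atTop, ∀ᶠ s in 𝓝 t, σ (p n s) * σ (q n s) = 1 := by
    intro t ht
    have h1 : Tendsto (fun n : ℕ => p n t) atTop atTop :=
      tendsto_atTop_add_const_right _ _ ((tendsto_natCast_atTop_atTop.atTop_add
        tendsto_const_nhds).atTop_mul_const (sub_pos.2 ht.1))
    have h2 : Tendsto (fun n : ℕ => q n t) atTop atTop :=
      tendsto_atTop_add_const_right _ _ ((tendsto_natCast_atTop_atTop.atTop_add
        tendsto_const_nhds).atTop_mul_const (sub_pos.2 ht.2))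
    filter_upwards [h1.eventually_gt_atTop 1, h2.eventually_gt_atTop 1] with n hn1 hn2
    have c1 : Continuous (p n) := by fun_prop
    have c2 : Continuous (q n) := by fun_prop
    filter_upwards [c1.continuousAt.eventually (lt_mem_nhds hn1),
      c2.continuousAt.eventually (lt_mem_nhds hn2)] with s hs1 hs2
    rw [hσ, Real.smoothTransition.one_of_one_le hs1.le,
      Real.smoothTransition.one_of_one_le hs2.le, one_mul]
  refine ⟨fun n t => σ (p n t) * σ (q n t), D + D, fun n => ?_, fun n t => ?_, fun n => ?_,
    fun t ht => ?_, fun t ht => ?_, fun n t ht => ?_⟩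
  · exact (Real.smoothTransition.contDiff.comp (by fun_prop)).mul
      (Real.smoothTransition.contDiff.comp (by fun_prop))
  · rw [abs_mul]
    exact mul_le_one₀ (hbd _) (abs_nonneg _) (hbd _)
  · have hn : (0 : ℝ) < (n : ℝ) + 1 := by positivity
    refine ⟨1 / ((n : ℝ) + 1), by positivity, fun t ht => ?_⟩
    rw [mem_Icc, not_and_or, not_le, not_le] at ht
    rcases ht with ht | ht
    · have : p n t ≤ 0 := by
        have h : t - a ≤ 1 / ((n : ℝ) + 1) := by linarith
        rw [le_div_iff₀ hn] at h
        simp only [p]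
        linarith
      exact mul_eq_zero_of_left (Real.smoothTransition.zero_of_nonpos this) _
    · have : q n t ≤ 0 := by
        have h : b - t ≤ 1 / ((n : ℝ) + 1) := by linarith
        rw [le_div_iff₀ hn] at h
        simp only [q]
        linarith
      exact mul_eq_zero_of_right _ (Real.smoothTransition.zero_of_nonpos this)
  · refine tendsto_const_nhds.congr' ?_
    filter_upwards [hev t ht] with n hn
    exact hn.self_of_nhds.symm
  · refine tendsto_const_nhds.congr' ?_
    filter_upwards [hev t ht] with n hn
    have : (fun t => σ (p n t) * σ (q n t)) =ᶠ[𝓝 t] fun _ => 1 := hn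
    rw [this.deriv_eq, deriv_const]
  · rw [(hder n t).deriv]
    have hn : (0 : ℝ) < (n : ℝ) + 1 := by positivity
    have hta := sub_pos.2 ht.1
    have htb := sub_pos.2 ht.2
    have hm : 0 ≤ min (t - a) (b - t) := le_min hta.le htb.le
    refine (mul_le_mul_of_nonneg_right (abs_add_le _ _) hm).trans ?_
    rw [add_mul]
    refine add_le_add ?_ ?_
    · rw [abs_mul, abs_mul, abs_of_pos hn]
      have h1 := hD (p n t) (by simp only [p]; nlinarith)
      calc |deriv σ (p n t)| * ((n : ℝ) + 1) * |σ (q n t)| * min (t - a) (b - t)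
          ≤ |deriv σ (p n t)| * ((n : ℝ) + 1) * 1 * (t - a) := by
            gcongr
            · exact hbd _
            · exact min_le_left _ _
        _ = |deriv σ (p n t)| * (p n t + 1) := by simp only [p]; ring
        _ ≤ D := h1
    · rw [abs_mul, abs_mul, abs_neg, abs_of_pos hn]
      have h1 := hD (q n t) (by simp only [q]; nlinarith)
      calc |σ (p n t)| * (|deriv σ (q n t)| * ((n : ℝ) + 1)) * min (t - a) (b - t)
          ≤ 1 * (|deriv σ (q n t)| * ((n : ℝ) + 1)) * (b - t) := by
            gcongr
            · exact hbd _
            · exact min_le_right _ _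
        _ = |deriv σ (q n t)| * (q n t + 1) := by simp only [q]; ring
        _ ≤ D := h1

/-- The weak gradient may be tested against products that vanish only on the two sides of the
rectangle perpendicular to the direction of differentiation. -/
theorem MemH1.integral_mul_prodFun {a b : Fin 2 → ℝ} {v : Plane → ℝ}
    {h : Plane → Plane} (hv : MemH1 (openRectangle a b) v h) {f : Fin 2 → ℝ → ℝ} {i : Fin 2}
    (hf : ∀ j, ContDiff ℝ ∞ (f j)) {M : ℝ}
    (hM : ∀ t ∈ Ioo (a i) (b i), |f i t| ≤ M * min (t - a i) (b i - t)) :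
    ∫ x in openRectangle a b, v x * prodFun (Function.update f i (deriv (f i))) x =
      -∫ x in openRectangle a b, h x i * prodFun f x := by
  choose θ D hθs hθ1 hθ0 hθlim hθlim' hθD using fun j => exists_cutoff (a j) (b j)
  have hθd : ∀ j n, Differentiable ℝ (θ j n) := fun j n => (hθs j n).differentiable (by simp)
  have hfd : ∀ j, Differentiable ℝ (f j) := fun j => (hf j).differentiable (by simp)
  -- Cutting off every factor gives an admissible test function, compactly supported in the open
  -- rectangle.
  let F : ℕ → Fin 2 → ℝ → ℝ := fun n j t => θ j n t * f j t
  have hFs : ∀ n j, ContDiff ℝ ∞ (F n j) := fun n j => (hθs j n).mul (hf j)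
  have hder : ∀ n t, deriv (F n i) t = deriv (θ i n) t * f i t + θ i n t * deriv (f i) t :=
    fun n t => ((hθd i n t).hasDerivAt.mul (hfd i t).hasDerivAt).deriv
  have hFc : ∀ n, HasCompactSupport (prodFun (F n)) ∧ tsupport (prodFun (F n)) ⊆
      openRectangle a b := by
    intro n
    choose δ hδ hδ0 using fun j => hθ0 j n
    have hsub : Function.support (prodFun (F n)) ⊆
        closedRectangle (fun j => a j + δ j) (fun j => b j - δ j) := by
      intro x hx j
      by_contra hj
      apply hx
      exact Finset.prod_eq_zero (Finset.mem_univ j) (by simp [F, hδ0 j _ hj])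
    have hK := isCompact_closedRectangle (fun j => a j + δ j) (fun j => b j - δ j)
    refine ⟨HasCompactSupport.of_support_subset_isCompact hK hsub,
      (closure_minimal hsub hK.isClosed).trans fun x hx j => ?_⟩
    have := hx j
    exact ⟨by linarith [this.1, hδ j], by linarith [this.2, hδ j]⟩
  have hbdd : ∀ g : ℝ → ℝ, Continuous g → ∀ j, ∃ C, ∀ t ∈ Ioo (a j) (b j), |g t| ≤ C := by
    intro g hg j
    obtain ⟨C, hC⟩ := (isCompact_Icc (a := a j) (b := b j)).exists_bound_of_continuousOn
      hg.continuousOn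
    exact ⟨C, fun t ht => hC t (Ioo_subset_Icc_self ht)⟩
  choose C hC using fun j => hbdd (f j) (hf j).continuous j
  obtain ⟨C', hC'⟩ := hbdd (deriv (f i)) ((hf i).continuous_deriv (by simp)) i
  have hFb : ∀ n j, ∀ t ∈ Ioo (a j) (b j), |F n j t| ≤ C j := by
    intro n j t ht
    simp only [F, abs_mul]
    exact (mul_le_of_le_one_left (abs_nonneg _) (hθ1 j n t)).trans (hC j t ht)
  have hFlim : ∀ j, ∀ t ∈ Ioo (a j) (b j), Tendsto (fun n => F n j t) atTop (𝓝 (f j t)) := by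
    intro j t ht
    simpa using (hθlim j t ht).mul_const (f j t)
  have l1 := tendsto_integral_mul_prodFun (a := a) (b := b) (u := fun x => h x i)
    ((hv.memLp_grad.eval_piLp i).integrable one_le_two)
    (fun n j => (hFs n j).continuous) hFb hFlim
  -- Only the cutoff in direction `i` is differentiated. The dangerous term `θ' f` is bounded by `M
  -- * D i`, the decay of `f i` at the end points absorbing the growth of `θ'`; the term `θ f'` is
  -- bounded by `C'`.
  have l2 := tendsto_integral_mul_prodFun (a := a) (b := b) (u := v)
    (F := fun n => Function.update (F n) i (deriv (F n i)))
    (f := Function.update f i (deriv (f i))) (C := Function.update C i (M * D i + C'))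
    (hv.memLp.integrable one_le_two) ?_ ?_ ?_
  · have heq : ∀ n, ∫ x in openRectangle a b,
        v x * prodFun (Function.update (F n) i (deriv (F n i))) x =
        -∫ x in openRectangle a b, h x i * prodFun (F n) x := by
      intro n
      have := hv.weakGradient _ (contDiff_prodFun (hFs n)) (hFc n).1 (hFc n).2 i
      simpa only [fderiv_prodFun (fun j => (hFs n j).differentiable (by simp))] using this
    simp only [heq] at l2
    exact tendsto_nhds_unique l2 l1.neg
  · intro n j
    by_cases hj : j = i
    · subst hj
      simpa using (hFs n j).continuous_deriv (by simp)
    · simpa [hj] using (hFs n j).continuous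
  · intro n j t ht
    by_cases hj : j = i
    · subst hj
      simp only [Function.update_self, hder]
      refine (abs_add_le _ _).trans (add_le_add ?_ ?_)
      · rw [abs_mul]
        have hm : 0 < min (t - a j) (b j - t) := lt_min (sub_pos.2 ht.1) (sub_pos.2 ht.2)
        have hM0 : 0 ≤ M := by
          have := (abs_nonneg _).trans (hM t ht)
          exact nonneg_of_mul_nonneg_left this hm
        calc |deriv (θ j n) t| * |f j t|
            ≤ |deriv (θ j n) t| * (M * min (t - a j) (b j - t)) := by gcongr; exact hM t ht
          _ = M * (|deriv (θ j n) t| * min (t - a j) (b j - t)) := by ring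
          _ ≤ M * D j := by gcongr; exact hθD j n t ht
      · rw [abs_mul]
        exact (mul_le_of_le_one_left (abs_nonneg _) (hθ1 j n t)).trans (hC' t ht)
    · simpa [hj] using hFb n j t ht
  · intro j t ht
    by_cases hj : j = i
    · subst hj
      simp only [Function.update_self, hder]
      simpa using ((hθlim' j t ht).mul_const (f j t)).add
        ((hθlim j t ht).mul_const (deriv (f j) t))
    · simpa [hj] using hFlim j t ht

end Rectangle

/-! ### Product cosines as Neumann eigenfunctions. -/

section CosineBasis

theorem Continuous.memLp_openRectangle {E : Type*} [NormedAddCommGroup E]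
    [SecondCountableTopology E] {f : Plane → E} (hf : Continuous f) (a b : Fin 2 → ℝ) :
    MemLp f 2 (volume.restrict (openRectangle a b)) := by
  obtain ⟨C, hC⟩ := (isCompact_closedRectangle a b).exists_bound_of_continuousOn hf.continuousOn
  refine MemLp.of_bound hf.aestronglyMeasurable C ?_
  refine (ae_restrict_iff' (isOpen_openRectangle a b).measurableSet).2 (.of_forall ?_)
  exact fun x hx => hC x (openRectangle_subset_closedRectangle a b hx)

/-- The classical gradient. -/
noncomputable def classicalGradient (u : Plane → ℝ) (x : Plane) : Plane :=
  WithLp.toLp 2 fun i => fderiv ℝ u x (EuclideanSpace.single i 1)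

theorem continuous_classicalGradient {u : Plane → ℝ} (hu : ContDiff ℝ ∞ u) :
    Continuous (classicalGradient u) := by
  unfold classicalGradient
  have := hu.continuous_fderiv (by simp)
  fun_prop

theorem memH1_of_contDiff {u : Plane → ℝ} (hu : ContDiff ℝ ∞ u) (a b : Fin 2 → ℝ) :
    MemH1 (openRectangle a b) u (classicalGradient u) where
  memLp := hu.continuous.memLp_openRectangle a b
  memLp_grad := (continuous_classicalGradient hu).memLp_openRectangle a b
  weakGradient := by
    intro η h1 h2 h3 i
    have hη' : Continuous fun x => fderiv ℝ η x (EuclideanSpace.single i 1) :=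
      (h1.continuous_fderiv (by simp)).clm_apply continuous_const
    have hu' : Continuous fun x => fderiv ℝ u x (EuclideanSpace.single i 1) :=
      (hu.continuous_fderiv (by simp)).clm_apply continuous_const
    have z1 : ∀ x, x ∉ openRectangle a b → η x = 0 := fun x hx =>
      image_eq_zero_of_notMem_tsupport fun h => hx (h3 h)
    have z2 : ∀ x, x ∉ openRectangle a b → fderiv ℝ η x (EuclideanSpace.single i 1) = 0 := by
      intro x hx
      have : fderiv ℝ η x = 0 := image_eq_zero_of_notMem_tsupport fun h =>
        hx (h3 (tsupport_fderiv_subset ℝ h))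
      simp [this]
    -- Since `η` is supported in the rectangle, both integrals extend to the whole plane, where
    -- integration by parts has no boundary term.
    rw [setIntegral_eq_integral_of_forall_compl_eq_zero fun x hx => by rw [z2 x hx, mul_zero],
      setIntegral_eq_integral_of_forall_compl_eq_zero fun x hx => by rw [z1 x hx, mul_zero]]
    refine integral_mul_fderiv_eq_neg_fderiv_mul_of_integrable ?_ ?_ ?_
      (fun x _ => hu.differentiable (by simp) x) (fun x _ => h1.differentiable (by simp) x)
    · exact (hu'.mul h1.continuous).integrable_of_hasCompactSupport h2.mul_left
    · exact (hu.continuous.mul hη').integrable_of_hasCompactSupport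
        (h2.fderiv_apply ℝ _).mul_left
    · exact (hu.continuous.mul h1.continuous).integrable_of_hasCompactSupport h2.mul_left

theorem prodFun_update_const_mul (f : Fin 2 → ℝ → ℝ) (i : Fin 2) (c : ℝ) (x : Plane) :
    prodFun (Function.update f i fun t => c * f i t) x = c * prodFun f x := by
  fin_cases i <;> simp [prodFun, Fin.prod_univ_two, Function.update] <;> ring

/-- The angular frequency `n π / (bⱼ - aⱼ)`. -/
noncomputable def cosFreq (a b : Fin 2 → ℝ) (j : Fin 2) (n : ℕ) : ℝ := n * Real.pi / (b j - a j)

/-- The one-dimensional Neumann eigenfunction of index `n` in direction `j`. -/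
noncomputable def cosFactor (a b : Fin 2 → ℝ) (j : Fin 2) (n : ℕ) (t : ℝ) : ℝ :=
  Real.cos (cosFreq a b j n * (t - a j))

/-- The product cosine mode of the rectangle with index `k`. -/
noncomputable def cosMode (a b : Fin 2 → ℝ) (k : Fin 2 → ℕ) : Plane → ℝ :=
  prodFun fun j => cosFactor a b j (k j)

variable (a b : Fin 2 → ℝ)

theorem contDiff_cosFactor (j : Fin 2) (n : ℕ) : ContDiff ℝ ∞ (cosFactor a b j n) := by
  unfold cosFactor
  fun_prop

theorem contDiff_cosMode (k : Fin 2 → ℕ) : ContDiff ℝ ∞ (cosMode a b k) :=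
  contDiff_prodFun fun j => contDiff_cosFactor a b j (k j)

theorem deriv_cosFactor (j : Fin 2) (n : ℕ) : deriv (cosFactor a b j n) = fun t =>
    -cosFreq a b j n * Real.sin (cosFreq a b j n * (t - a j)) := by
  ext t
  have h : HasDerivAt (fun t => cosFreq a b j n * (t - a j)) (cosFreq a b j n) t := by
    simpa using ((hasDerivAt_id t).sub_const (a j)).const_mul (cosFreq a b j n)
  unfold cosFactor
  rw [h.cos.deriv]
  ring

theorem deriv_deriv_cosFactor (j : Fin 2) (n : ℕ) : deriv (deriv (cosFactor a b j n)) =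
    fun t => -cosFreq a b j n ^ 2 * cosFactor a b j n t := by
  rw [deriv_cosFactor]
  ext t
  have h : HasDerivAt (fun t => cosFreq a b j n * (t - a j)) (cosFreq a b j n) t := by
    simpa using ((hasDerivAt_id t).sub_const (a j)).const_mul (cosFreq a b j n)
  rw [(h.sin.const_mul _).deriv, cosFactor]
  ring

variable {a b}

/-- This is the Neumann condition in quantitative form: `|sin s| ≤ |s|` at the left end, and the
same after the reflection `s ↦ n π - s` at the right end. -/
theorem abs_sin_cosFreq_le (hab : ∀ i, a i < b i) (j : Fin 2) (n : ℕ) {t : ℝ}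
    (ht : t ∈ Ioo (a j) (b j)) : |Real.sin (cosFreq a b j n * (t - a j))| ≤
      cosFreq a b j n * min (t - a j) (b j - t) := by
  have hL := sub_pos.2 (hab j)
  have hw : 0 ≤ cosFreq a b j n := by
    unfold cosFreq
    positivity
  have hsin : ∀ s, |Real.sin s| ≤ |s| := fun s => Real.abs_sin_le_abs
  rw [mul_min_of_nonneg _ _ hw, le_min_iff]
  constructor
  · refine (hsin _).trans_eq (abs_of_nonneg (mul_nonneg hw (sub_nonneg.2 ht.1.le)))
  · have : cosFreq a b j n * (t - a j) = n * Real.pi - cosFreq a b j n * (b j - t) := by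
      unfold cosFreq
      field_simp
      ring
    rw [this, Real.sin_nat_mul_pi_sub, abs_neg, abs_mul, abs_pow, abs_neg, abs_one, one_pow,
      one_mul]
    exact (hsin _).trans_eq (abs_of_nonneg (mul_nonneg hw (sub_nonneg.2 ht.2.le)))

/-- The weak eigenvalue equation for a cosine mode, one direction at a time. -/
theorem integral_fderiv_cosMode_mul (hab : ∀ i, a i < b i) (k : Fin 2 → ℕ) {v : Plane → ℝ}
    {h : Plane → Plane} (hv : MemH1 (openRectangle a b) v h) (i : Fin 2) :
    ∫ x in openRectangle a b,
        fderiv ℝ (cosMode a b k) x (EuclideanSpace.single i 1) * h x i =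
      cosFreq a b i (k i) ^ 2 * ∫ x in openRectangle a b, cosMode a b k x * v x := by
  have hs : ∀ j, ContDiff ℝ ∞ (Function.update (fun j => cosFactor a b j (k j)) i
      (deriv (cosFactor a b i (k i))) j) := by
    intro j
    by_cases hj : j = i
    · subst hj
      simp only [Function.update_self, deriv_cosFactor]
      fun_prop
    · simpa [hj] using contDiff_cosFactor a b j (k j)
  -- The test product already contains the derivative of the `i`-th cosine. One frequency factor in
  -- `M` comes from that derivative, the other from the bound on the sine.
  have key := hv.integral_mul_prodFun (i := i) hs
    (M := cosFreq a b i (k i) * cosFreq a b i (k i)) (fun t ht => by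
      rw [Function.update_self, deriv_cosFactor]
      have hw : 0 ≤ cosFreq a b i (k i) := by
        have := sub_pos.2 (hab i)
        unfold cosFreq
        positivity
      rw [abs_mul, abs_neg, abs_of_nonneg hw, mul_assoc]
      exact mul_le_mul_of_nonneg_left (abs_sin_cosFreq_le hab i (k i) ht) hw)
  rw [Function.update_self, Function.update_idem, deriv_deriv_cosFactor] at key
  simp only [prodFun_update_const_mul (fun j => cosFactor a b j (k j)) i] at key
  have e : ∀ x, fderiv ℝ (cosMode a b k) x (EuclideanSpace.single i 1) =
      prodFun (Function.update (fun j => cosFactor a b j (k j)) i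
        (deriv (cosFactor a b i (k i)))) x := fun x =>
    fderiv_prodFun (fun j => (contDiff_cosFactor a b j (k j)).differentiable (by simp)) x i
  have e2 : ∫ x in openRectangle a b, v x * (-cosFreq a b i (k i) ^ 2 *
      prodFun (fun j => cosFactor a b j (k j)) x) =
      -(cosFreq a b i (k i) ^ 2 * ∫ x in openRectangle a b, cosMode a b k x * v x) := by
    rw [← integral_const_mul, ← integral_neg]
    congr 1
    ext x
    unfold cosMode
    ring
  rw [e2, neg_inj] at key
  rw [key]
  simp only [e, mul_comm]

/-- The Neumann eigenvalue of a cosine mode. -/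
noncomputable def cosEigenvalue (a b : Fin 2 → ℝ) (k : Fin 2 → ℕ) : ℝ :=
  ∑ i, cosFreq a b i (k i) ^ 2

theorem integral_inner_classicalGradient_cosMode (hab : ∀ i, a i < b i) (k : Fin 2 → ℕ)
    {v : Plane → ℝ} {h : Plane → Plane} (hv : MemH1 (openRectangle a b) v h) :
    ∫ x in openRectangle a b, inner ℝ (classicalGradient (cosMode a b k) x) (h x) =
      cosEigenvalue a b k * ∫ x in openRectangle a b, cosMode a b k x * v x := by
  have e : ∀ x, inner ℝ (classicalGradient (cosMode a b k) x) (h x) =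
      ∑ i, fderiv ℝ (cosMode a b k) x (EuclideanSpace.single i 1) * h x i := by
    intro x
    simp [PiLp.inner_apply, classicalGradient, mul_comm]
  simp only [e, cosEigenvalue, Finset.sum_mul]
  rw [integral_finsetSum]
  · exact Finset.sum_congr rfl fun i _ => integral_fderiv_cosMode_mul hab k hv i
  · intro i _
    exact ((memH1_of_contDiff (contDiff_cosMode a b k) a b).memLp_grad.eval_piLp i).integrable_mul
      (hv.memLp_grad.eval_piLp i)

theorem cosFreq_sq_injective (hab : ∀ i, a i < b i) (i : Fin 2) :
    Function.Injective fun n => cosFreq a b i n ^ 2 := by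
  intro m n hmn
  have hL := sub_pos.2 (hab i)
  have h := (pow_left_inj₀ (by unfold cosFreq; positivity) (by unfold cosFreq; positivity)
    two_ne_zero).1 hmn
  unfold cosFreq at h
  have hpi := Real.pi_ne_zero
  field_simp at h
  exact_mod_cast h

/-- The symmetry argument is run in a single direction where the indices differ. The full
eigenvalues would not do, since distinct indices may share one, as on a square. -/
theorem integral_cosMode_mul_cosMode (hab : ∀ i, a i < b i) {k l : Fin 2 → ℕ} (hkl : k ≠ l) :
    ∫ x in openRectangle a b, cosMode a b k x * cosMode a b l x = 0 := by
  obtain ⟨i, hi⟩ := Function.ne_iff.1 hkl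
  have h1 := integral_fderiv_cosMode_mul hab k (memH1_of_contDiff (contDiff_cosMode a b l) a b) i
  have h2 := integral_fderiv_cosMode_mul hab l (memH1_of_contDiff (contDiff_cosMode a b k) a b) i
  simp only [classicalGradient] at h1 h2
  simp only [mul_comm (fderiv ℝ (cosMode a b l) _ _), mul_comm (cosMode a b l _)] at h2
  rw [h1] at h2
  by_contra h0
  exact hi (cosFreq_sq_injective hab i (mul_right_cancel₀ h0 h2))

theorem cosMode_not_ae_zero (hab : ∀ i, a i < b i) (k : Fin 2 → ℕ) :
    ¬ cosMode a b k =ᵐ[volume.restrict (openRectangle a b)] 0 := by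
  intro h
  have h0 := Measure.eqOn_open_of_ae_eq h (isOpen_openRectangle a b)
    (contDiff_cosMode a b k).continuous.continuousOn continuousOn_const
  -- At this point each cosine has argument `(π / 2) * k / (k + 1)`, below `π / 2`, so the mode is
  -- positive there.
  let x : Plane := WithLp.toLp 2 fun j => a j + (b j - a j) / (2 * (k j + 1))
  have hx : x ∈ openRectangle a b := by
    intro j
    have hL := sub_pos.2 (hab j)
    have hlt : (b j - a j) / (2 * ((k j : ℝ) + 1)) < b j - a j := by
      rw [div_lt_iff₀ (by positivity)]
      nlinarith [(k j).cast_nonneg (α := ℝ)]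
    exact ⟨lt_add_of_pos_right _ (by positivity), by simp only [x]; linarith⟩
  have hpos : 0 < cosMode a b k x := by
    unfold cosMode prodFun
    refine Finset.prod_pos fun j _ => Real.cos_pos_of_mem_Ioo ?_
    have hL := sub_pos.2 (hab j)
    have : cosFreq a b j (k j) * (x j - a j) =
        (Real.pi / 2) * (k j / ((k j : ℝ) + 1)) := by
      simp only [cosFreq, x]
      field_simp
      ring
    rw [this]
    have hpi := Real.pi_pos
    constructor
    · exact (neg_lt_zero.2 (by positivity)).trans_le (by positivity)
    · refine mul_lt_of_lt_one_right (by positivity) ?_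
      rw [div_lt_one (by positivity)]
      linarith
  exact hpos.ne' (h0 hx)

/-! ### Completeness of the cosine modes. -/

theorem cosFactor_mul_cosFactor (j : Fin 2) (m n : ℕ) (t : ℝ) :
    cosFactor a b j m t * cosFactor a b j n t =
      (1 / 2) * (cosFactor a b j (m + n) t + cosFactor a b j (m - n + (n - m)) t) := by
  -- With truncated subtraction, `m - n + (n - m)` is `|m - n|`; cosine is even, so the sign of the
  -- difference is irrelevant.
  have hd : cosFactor a b j (m - n + (n - m)) t =
      Real.cos (cosFreq a b j m * (t - a j) - cosFreq a b j n * (t - a j)) := by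
    unfold cosFactor cosFreq
    rcases le_total m n with h | h
    · rw [← Real.cos_neg, Nat.sub_eq_zero_of_le h, zero_add, Nat.cast_sub h]
      congr 1
      ring
    · rw [Nat.sub_eq_zero_of_le h, add_zero, Nat.cast_sub h]
      congr 1
      ring
  have hs : cosFactor a b j (m + n) t =
      Real.cos (cosFreq a b j m * (t - a j) + cosFreq a b j n * (t - a j)) := by
    unfold cosFactor cosFreq
    push_cast
    congr 1
    ring
  rw [hd, hs, Real.cos_add, Real.cos_sub, cosFactor, cosFactor]
  ring

variable (a b)

/-- The cosine modes as continuous maps. -/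
noncomputable def cosModeMap (k : Fin 2 → ℕ) : C(Plane, ℝ) :=
  ⟨cosMode a b k, (contDiff_cosMode a b k).continuous⟩

/-- The product-to-sum formula in each variable yields four modes. This makes the linear span an
algebra, as Stone–Weierstrass requires. -/
theorem cosModeMap_mul_mem (k l : Fin 2 → ℕ) :
    cosModeMap a b k * cosModeMap a b l ∈ Submodule.span ℝ (range (cosModeMap a b)) := by
  let s : Fin 2 → ℕ := fun j => k j + l j
  let d : Fin 2 → ℕ := fun j => k j - l j + (l j - k j)
  have h : cosModeMap a b k * cosModeMap a b l = (1 / 4 : ℝ) •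
      (cosModeMap a b ![s 0, s 1] + cosModeMap a b ![s 0, d 1] + cosModeMap a b ![d 0, s 1] +
        cosModeMap a b ![d 0, d 1]) := by
    ext x
    have h0 := cosFactor_mul_cosFactor (a := a) (b := b) 0 (k 0) (l 0) (x 0)
    have h1 := cosFactor_mul_cosFactor (a := a) (b := b) 1 (k 1) (l 1) (x 1)
    simp only [cosModeMap, cosMode, prodFun, Fin.prod_univ_two, ContinuousMap.mul_apply,
      ContinuousMap.coe_mk, ContinuousMap.smul_apply, ContinuousMap.add_apply, smul_eq_mul,
      Matrix.cons_val_zero, Matrix.cons_val_one]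
    rw [mul_mul_mul_comm, h0, h1]
    ring
  have hm : ∀ k, cosModeMap a b k ∈ Submodule.span ℝ (range (cosModeMap a b)) :=
    fun k => Submodule.subset_span ⟨k, rfl⟩
  rw [h]
  exact Submodule.smul_mem _ _ (add_mem (add_mem (add_mem (hm _) (hm _)) (hm _)) (hm _))

theorem cosModeMap_zero : cosModeMap a b 0 = 1 := by
  ext x
  simp [cosModeMap, cosMode, prodFun, cosFactor, cosFreq]

/-- The algebra of cosine polynomials. -/
noncomputable def cosPolynomials : Subalgebra ℝ C(Plane, ℝ) :=
  (Submodule.span ℝ (range (cosModeMap a b))).toSubalgebra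
    (Submodule.subset_span ⟨0, cosModeMap_zero a b⟩) fun x y hx hy => by
      have := Submodule.mul_mem_mul hx hy
      rw [Submodule.span_mul_span] at this
      refine Submodule.span_le.2 ?_ this
      rintro _ ⟨_, ⟨k, rfl⟩, _, ⟨l, rfl⟩, rfl⟩
      exact cosModeMap_mul_mem a b k l

variable {a b}

theorem exists_cosPolynomial_near (hab : ∀ i, a i < b i) {f : Plane → ℝ} (hf : Continuous f)
    {ε : ℝ} (hε : 0 < ε) :
    ∃ p ∈ Submodule.span ℝ (range (cosModeMap a b)),
      ∀ x ∈ openRectangle a b, |f x - p x| ≤ ε := by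
  have : CompactSpace (closedRectangle a b) :=
    isCompact_iff_compactSpace.1 (isCompact_closedRectangle a b)
  let ι : C(closedRectangle a b, Plane) := ⟨Subtype.val, continuous_subtype_val⟩
  let A := (cosPolynomials a b).map (ContinuousMap.compRightAlgHom ℝ ℝ ι)
  have hA : A.SeparatesPoints := by
    intro x y hxy
    have hxy' : ∃ j, x.1 j ≠ y.1 j := by
      by_contra! h
      exact hxy (Subtype.ext (PiLp.ext h))
    obtain ⟨j, hj⟩ := hxy'
    -- Points differing in coordinate `j` are separated by the first mode in that direction, because
    -- cosine is injective on `[0, π]`.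
    refine ⟨_, ⟨_, ⟨cosModeMap a b (Pi.single j 1), Submodule.subset_span ⟨_, rfl⟩, rfl⟩, rfl⟩, ?_⟩
    have hL := sub_pos.2 (hab j)
    have hmode : ∀ z : Plane, cosMode a b (Pi.single j 1) z =
        Real.cos (Real.pi / (b j - a j) * (z j - a j)) := by
      intro z
      unfold cosMode prodFun
      rw [Finset.prod_eq_single j]
      · simp [cosFactor, cosFreq]
      · intro i _ hi
        simp [cosFactor, cosFreq, hi]
      · simp
    have hmem : ∀ z : closedRectangle a b,
        Real.pi / (b j - a j) * (z.1 j - a j) ∈ Icc 0 Real.pi := by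
      intro z
      have hz := z.2 j
      have hpi := Real.pi_pos
      constructor
      · exact mul_nonneg (by positivity) (sub_nonneg.2 hz.1)
      · rw [div_mul_eq_mul_div, div_le_iff₀ hL]
        gcongr
        exact hz.2
    intro he
    have he' : cosMode a b (Pi.single j 1) x.1 = cosMode a b (Pi.single j 1) y.1 := he
    rw [hmode, hmode] at he'
    have := Real.injOn_cos (hmem x) (hmem y) he'
    have hne : Real.pi / (b j - a j) ≠ 0 := by positivity
    exact hj (by linarith [mul_left_cancel₀ hne this])
  have hdense := ContinuousMap.subalgebra_topologicalClosure_eq_top_of_separatesPoints A hA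
  have hmem : (⟨f, hf⟩ : C(Plane, ℝ)).comp ι ∈ closure (A : Set C(closedRectangle a b, ℝ)) := by
    rw [← Subalgebra.topologicalClosure_coe, hdense]
    trivial
  obtain ⟨_, ⟨p, hp, rfl⟩, hd⟩ := Metric.mem_closure_iff.1 hmem ε hε
  refine ⟨p, hp, fun x hx => ?_⟩
  have := (ContinuousMap.dist_lt_iff hε).1 hd ⟨x, openRectangle_subset_closedRectangle a b hx⟩
  exact this.le

/-- Orthogonality to all modes passes to cosine polynomials by linearity, then to smooth test
functions by uniform approximation, integrability of `u` controlling the error. -/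
theorem ae_eq_zero_of_forall_integral_cosMode_mul (hab : ∀ i, a i < b i) {u : Plane → ℝ}
    (hu : IntegrableOn u (openRectangle a b))
    (h : ∀ k, ∫ x in openRectangle a b, cosMode a b k x * u x = 0) :
    u =ᵐ[volume.restrict (openRectangle a b)] 0 := by
  have hmeas := (isOpen_openRectangle a b).measurableSet
  have hint : ∀ p : Plane → ℝ, Continuous p →
      IntegrableOn (fun x => p x * u x) (openRectangle a b) := by
    intro p hp
    obtain ⟨C, hC⟩ := (isCompact_closedRectangle a b).exists_bound_of_continuousOn
      hp.continuousOn
    refine hu.bdd_mul (c := C) hp.aestronglyMeasurable ?_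
    exact (ae_restrict_iff' hmeas).2 (.of_forall fun x hx =>
      hC x (openRectangle_subset_closedRectangle a b hx))
  have hspan : ∀ p ∈ Submodule.span ℝ (range (cosModeMap a b)),
      ∫ x in openRectangle a b, p x * u x = 0 := by
    intro p hp
    induction hp using Submodule.span_induction with
    | mem x hx =>
      obtain ⟨k, rfl⟩ := hx
      exact h k
    | zero => simp
    | add x y _ _ hx hy =>
      simp only [ContinuousMap.add_apply, add_mul]
      rw [integral_add (hint x x.continuous) (hint y y.continuous), hx, hy, add_zero]
    | smul c x _ hx =>
      simp only [ContinuousMap.smul_apply, smul_eq_mul, mul_assoc, integral_const_mul, hx,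
        mul_zero]
  have key : ∀ᵐ x, x ∈ openRectangle a b → u x = 0 := by
    refine (isOpen_openRectangle a b).ae_eq_zero_of_integral_contDiff_smul_eq_zero
      hu.locallyIntegrableOn fun η h1 _ h3 => ?_
    have hz : ∀ x, x ∉ openRectangle a b → η x • u x = 0 := by
      intro x hx
      rw [image_eq_zero_of_notMem_tsupport fun h => hx (h3 h), zero_smul]
    rw [← setIntegral_eq_integral_of_forall_compl_eq_zero hz]
    simp only [smul_eq_mul]
    set I := ∫ x in openRectangle a b, |u x| with hI
    have hI0 : 0 ≤ I := integral_nonneg fun x => abs_nonneg _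
    have hle : ∀ ε > 0, |∫ x in openRectangle a b, η x * u x| ≤ ε := by
      intro ε hε
      -- The denominator is `I + 1` rather than `I` because `I` may vanish.
      obtain ⟨p, hp, hpη⟩ := exists_cosPolynomial_near hab h1.continuous
        (show 0 < ε / (I + 1) by positivity)
      have e : ∫ x in openRectangle a b, η x * u x =
          ∫ x in openRectangle a b, (η x - p x) * u x := by
        simp only [sub_mul]
        rw [integral_sub (hint η h1.continuous) (hint p p.continuous), hspan p hp, sub_zero]
      rw [e]
      calc |∫ x in openRectangle a b, (η x - p x) * u x|
          ≤ ∫ x in openRectangle a b, |(η x - p x) * u x| := abs_integral_le_integral_abs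
        _ ≤ ∫ x in openRectangle a b, ε / (I + 1) * |u x| := by
            refine setIntegral_mono_on (hint _ (h1.continuous.sub p.continuous)).abs
              (hu.abs.const_mul _) hmeas fun x hx => ?_
            rw [abs_mul]
            gcongr
            exact hpη x hx
        _ = ε / (I + 1) * I := integral_const_mul _ _
        _ ≤ ε := by
            rw [div_mul_eq_mul_div, div_le_iff₀ (by positivity)]
            nlinarith
    exact abs_nonpos_iff.1 (le_of_forall_pos_le_add fun ε hε => by simpa using hle ε hε)
  exact (ae_restrict_iff' hmeas).2 key

theorem nonempty_neumannEigenbasis (hab : ∀ i, a i < b i) :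
    Nonempty (NeumannEigenbasis (openRectangle a b) (Fin 2 → ℕ)) := by
  have hmem : ∀ k, MemLp (cosMode a b k) 2 (volume.restrict (openRectangle a b)) :=
    fun k => (contDiff_cosMode a b k).continuous.memLp_openRectangle a b
  let E := fun k => (hmem k).toLp (cosMode a b k)
  let c : (Fin 2 → ℕ) → ℝ := fun k => ‖E k‖⁻¹
  have hE : ∀ k, ‖E k‖ ≠ 0 := fun k h0 => cosMode_not_ae_zero hab k
    ((hmem k).coeFn_toLp.symm.trans (Lp.eq_zero_iff_ae_eq_zero.1 (norm_eq_zero.1 h0)))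
  have hc : ∀ k, c k ≠ 0 := fun k => inv_ne_zero (hE k)
  have hon : Orthonormal ℝ fun k => c k • E k := by
    refine ⟨fun k => ?_, fun k l hkl => ?_⟩
    · rw [norm_smul, norm_inv, norm_norm]
      exact inv_mul_cancel₀ (hE k)
    · simp only [inner_smul_left, inner_smul_right, E, inner_toLp_toLp]
      have := integral_cosMode_mul_cosMode hab hkl.symm
      simp [this]
  have horth : (Submodule.span ℝ (range fun k => c k • E k))ᗮ = ⊥ := by
    rw [eq_bot_iff]
    intro x hx
    rw [Submodule.mem_bot, Lp.eq_zero_iff_ae_eq_zero]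
    refine ae_eq_zero_of_forall_integral_cosMode_mul hab
      ((Lp.memLp x).integrable one_le_two) fun k => ?_
    have h1 := (Submodule.mem_orthogonal _ _).1 hx _ (Submodule.subset_span ⟨k, rfl⟩)
    rw [inner_smul_left, real_inner_comm, inner_coe_toLp] at h1
    have h2 := (mul_eq_zero.1 h1).resolve_left (by simpa using hc k)
    simpa only [mul_comm] using h2
  let B := HilbertBasis.mkOfOrthogonalEqBot hon horth
  have hB : ∀ k, (fun x => c k * cosMode a b k x) =ᵐ[volume.restrict (openRectangle a b)]
      B k := by
    intro k
    have : B k = c k • E k := by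
      simp only [B, HilbertBasis.coe_mkOfOrthogonalEqBot]
    rw [this]
    filter_upwards [Lp.coeFn_smul (c k) (E k), (hmem k).coeFn_toLp] with x h1 h2
    rw [h1, Pi.smul_apply, h2, smul_eq_mul]
  have heig : ∀ j, cosEigenvalue a b (Pi.single j 1) = (Real.pi / (b j - a j)) ^ 2 := by
    intro j
    unfold cosEigenvalue
    rw [Finset.sum_eq_single j]
    · simp [cosFreq]
    · intro i _ hi
      simp [cosFreq, hi]
    · simp
  -- The first nonconstant mode oscillates once along a longest side.
  obtain ⟨i, hi⟩ := Finite.exists_min fun j => (Real.pi / (b j - a j)) ^ 2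
  refine ⟨{
    basis := B
    grad := fun k x => c k • classicalGradient (cosMode a b k) x
    eig := cosEigenvalue a b
    memH1 := fun k => ((memH1_of_contDiff (contDiff_cosMode a b k) a b).const_mul (c k)).congr_ae
      (hB k) (Filter.EventuallyEq.refl _ _)
    weak := fun k v h hv => ?_
    zero := 0
    eig_zero := by simp [cosEigenvalue, cosFreq]
    const_zero := ⟨c 0, hc 0, ?_⟩
    first := Pi.single i 1
    eig_first_pos := ?_
    eig_first_le := fun k hk => ?_ }⟩
  · simp only [inner_smul_left, integral_const_mul, conj_trivial]
    rw [integral_inner_classicalGradient_cosMode hab k hv]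
    have : ∫ x in openRectangle a b, B k x * v x =
        c k * ∫ x in openRectangle a b, cosMode a b k x * v x := by
      rw [← integral_const_mul]
      refine integral_congr_ae ((hB k).mono fun x hx => ?_)
      simp only [← hx, mul_assoc]
    rw [this]
    ring
  · refine (hB 0).symm.trans (.of_forall fun x => ?_)
    have := DFunLike.congr_fun (cosModeMap_zero a b) x
    simp only [cosModeMap, ContinuousMap.coe_mk, ContinuousMap.one_apply] at this
    simp only [this, mul_one]
  · rw [heig]
    have := sub_pos.2 (hab i)
    have := Real.pi_pos
    positivity
  -- A nonzero index has `k j ≥ 1` for some `j`, and that direction alone contributes at least `(π /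
  -- (b j - a j))²`.
  · obtain ⟨j, hj⟩ := Function.ne_iff.1 hk
    have hL := sub_pos.2 (hab j)
    rw [heig]
    refine (hi j).trans ?_
    have h1 : (1 : ℝ) ≤ k j := by exact_mod_cast Nat.one_le_iff_ne_zero.2 hj
    have hpi := Real.pi_pos
    calc (Real.pi / (b j - a j)) ^ 2 ≤ cosFreq a b j (k j) ^ 2 := by
          unfold cosFreq
          gcongr
          exact le_mul_of_one_le_left hpi.le h1
      _ ≤ cosEigenvalue a b k :=
          Finset.single_le_sum (f := fun j => cosFreq a b j (k j) ^ 2)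
            (fun _ _ => sq_nonneg _) (Finset.mem_univ j)

end CosineBasis

/-! ### Residual densities of floorplans have zero mean. -/

section Floorplan

theorem memL2Zero_residualDensity {a b : Fin 2 → ℝ} (hab : ∀ i, a i < b i) {n : ℕ}
    {S : Fin n → Set Plane} {c : Fin n → Plane} (hS : ∀ i, MeasurableSet (S i))
    (hsub : ∀ i, placedModule (S i) (c i) ⊆ closure (openRectangle a b)) :
    MemL2Zero (openRectangle a b) (residualDensity (openRectangle a b) S c) := by
  have hM : ∀ i, MeasurableSet (placedModule (S i) (c i)) := fun i => (hS i).const_vadd (c i)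
  have hmem : ∀ i, MemLp ((placedModule (S i) (c i)).indicator fun _ => (1 : ℝ)) 2
      (volume.restrict (openRectangle a b)) := fun i => (memLp_const 1).indicator (hM i)
  have hdens : MemLp (density S c) 2 (volume.restrict (openRectangle a b)) := by
    unfold density
    exact memLp_finsetSum _ fun i _ => hmem i
  refine ⟨hdens.sub (memLp_const _), ?_⟩
  have hvol : ∀ i, (volume.restrict (openRectangle a b)).real (placedModule (S i) (c i)) =
      volume.real (S i) := by
    intro i
    have h1 : (volume.restrict (openRectangle a b)) (placedModule (S i) (c i)) =
        volume (placedModule (S i) (c i)) := by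
      -- Modules may touch the boundary, which is null because the rectangle is convex, so
      -- restricting to the open rectangle loses no area.
      have hae : (openRectangle a b : Set Plane) =ᵐ[volume] closure (openRectangle a b) :=
        (closure_ae_eq_of_null_frontier
          ((convex_openRectangle a b).addHaar_frontier volume)).symm
      rw [Measure.restrict_congr_set hae, Measure.restrict_apply (hM i),
        inter_eq_left.2 (hsub i)]
    rw [measureReal_def, h1, placedModule, measure_vadd, measureReal_def]
  have hR : volume.real (openRectangle a b) ≠ 0 :=
    (ENNReal.toReal_pos ((isOpen_openRectangle a b).measure_pos volume
      (openRectangle_nonempty hab)).ne' (volume_openRectangle_lt_top a b).ne).ne'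
  unfold residualDensity
  rw [integral_sub (hdens.integrable one_le_two) (integrable_const _), setIntegral_const]
  unfold density averageDensity
  rw [integral_finsetSum _ fun i _ => (hmem i).integrable one_le_two]
  simp only [integral_indicator_const _ (hM _), hvol, smul_eq_mul, mul_one]
  rw [← mul_assoc, mul_one_div_cancel hR, one_mul, sub_self]

end Floorplan

theorem mainTheorem9 (a b : Fin 2 → ℝ) (hab : ∀ i, a i < b i) :
    -- the first nonzero eigenvalue exists and is positive
    IsLeast (nonzeroNeumannEigenvalues (openRectangle a b))
      (firstNeumannEigenvalue (openRectangle a b)) ∧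
    0 < firstNeumannEigenvalue (openRectangle a b) ∧
    -- every zero-mean square-integrable residual has a unique potential and obeys the bound
    (∀ r : Plane → ℝ, MemL2Zero (openRectangle a b) r →
      (∃ φ, IsPoissonPotential (openRectangle a b) r φ) ∧
      (∀ φ φ', IsPoissonPotential (openRectangle a b) r φ →
        IsPoissonPotential (openRectangle a b) r φ' →
        φ =ᵐ[volume.restrict (openRectangle a b)] φ') ∧
      poissonEnergy (openRectangle a b) r ≤
        1 / (2 * firstNeumannEigenvalue (openRectangle a b)) *
          ∫ x in openRectangle a b, r x ^ 2) ∧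
    -- in particular every floorplan obeys it
    (∀ (n : ℕ) (S : Fin n → Set Plane) (c : Fin n → Plane),
      (∀ i, MeasurableSet (S i)) →
      (∀ i, placedModule (S i) (c i) ⊆ closure (openRectangle a b)) →
      MemL2Zero (openRectangle a b) (residualDensity (openRectangle a b) S c) ∧
      floorplanEnergy (openRectangle a b) S c ≤
        1 / (2 * firstNeumannEigenvalue (openRectangle a b)) *
          densityVariance (openRectangle a b) S c) := by
  obtain ⟨B⟩ := nonempty_neumannEigenbasis hab
  refine ⟨?_, ?_, fun r hr => ⟨B.exists_isPoissonPotential hr,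
    fun φ φ' h h' => B.poissonPotential_unique h h', B.poissonEnergy_le hr⟩,
    fun n S c hS hsub => ?_⟩
  · rw [B.firstNeumannEigenvalue_eq]
    exact B.isLeast_nonzeroNeumannEigenvalues
  · rw [B.firstNeumannEigenvalue_eq]
    exact B.eig_first_pos
  · have h := memL2Zero_residualDensity hab hS hsub
    exact ⟨h, B.poissonEnergy_le h⟩
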